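/- Let $P,Q\in\mathbb C[z]$ be coprime polynomials with $P\neq 0$, and let $R=Q/P$. Let the affine inflection curve of $R$ be \[ \mathfrak I_R=\overline{\{z\in\mathbb C:\ R(z)\neq 0,\ P(z)\neq 0,\ \operatorname{Im}R'(z)=0\}}, \] the closure being taken in $\mathbb C$. Then every bounded connected component of $\mathfrak I_R$ contains at least one finite pole of $R$, that is, a point $p\in\mathbb C$ at which $R$ has a pole. -/

import Mathlib

open Polynomial

/-- The rational function `R = Q / P`, as a function on `ℂ` away from the zeros of `P`
(the value assigned at a zero of `P` is irrelevant below). -/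
noncomputable def ratFun (P Q : ℂ[X]) (z : ℂ) : ℂ := Q.eval z / P.eval z

/-- The regular affine inflection locus of `R = Q / P`:
the points where `R ≠ 0`, `P ≠ 0` and `Im R' = 0`. -/
def regularInflectionLocus (P Q : ℂ[X]) : Set ℂ :=
  {z : ℂ | ratFun P Q z ≠ 0 ∧ P.eval z ≠ 0 ∧ (deriv (ratFun P Q) z).im = 0}

/-- The affine inflection curve of `R = Q / P`: the closure in `ℂ` of the regular affine
inflection locus. -/
def inflectionCurve (P Q : ℂ[X]) : Set ℂ := closure (regularInflectionLocus P Q)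

/-- `p ∈ ℂ` is a (finite) pole of `R = Q / P`: the order of `R` at `p` is negative. -/
def IsFinitePole (P Q : ℂ[X]) (p : ℂ) : Prop := meromorphicOrderAt (ratFun P Q) p < 0

/-!
Suppose a bounded component `K` of the inflection curve contains no pole. The curve is closed, so `K`
is compact, and it can be separated from the rest of the curve: there is a compact set `S ⊇ {z}`
inside the curve, free of poles and relatively open in the curve
(`exists_isCompact_of_isBounded_connectedComponentIn`). On `S` the derivative `R'` is continuous and
real, so `Re R'` attains its maximum over `S` at some point `s`. If `R'` is not locally constant
at `s`, the open mapping theorem produces points near `s` at which `R'` is real and strictly larger;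
such points lie on the curve, hence in `S`, which is absurd. If `R'` is locally constant at `s`, it
is a real constant everywhere, the curve is the whole plane (`inflectionCurve_eq_univ`), and its
only component is unbounded.
-/

open Filter Topology

/-- A bounded component of a closed set `F`, disjoint from a closed set `C`, is contained in a
compact subset of `F` that is relatively open in `F` and still disjoint from `C`: inside a large
closed ball the component is the intersection of the relatively clopen sets containing it, and one
of these avoids both `C` and the boundary sphere. -/
lemma exists_isCompact_of_isBounded_connectedComponentIn {X : Type*} [MetricSpace X] [ProperSpace X]
    {F C : Set X} (hF : IsClosed F) (hC : IsClosed C) {z : X} (hz : z ∈ F)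
    (hb : Bornology.IsBounded (connectedComponentIn F z))
    (hd : Disjoint (connectedComponentIn F z) C) :
    ∃ S : Set X, IsCompact S ∧ z ∈ S ∧ S ⊆ F ∧ Disjoint S C ∧
      ∀ s ∈ S, ∀ᶠ x in 𝓝 s, x ∈ F → x ∈ S := by
  obtain ⟨r, hr⟩ := hb.subset_ball z
  have hzr : z ∈ Metric.ball z r := hr (mem_connectedComponentIn hz)
  set G : Set X := F ∩ Metric.closedBall z r
  have hGc : IsCompact G := (isCompact_closedBall z r).inter_left hF
  have hzG : z ∈ G := ⟨hz, Metric.ball_subset_closedBall hzr⟩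
  have : CompactSpace G := isCompact_iff_compactSpace.mp hGc
  have hcomp : ∀ x ∈ connectedComponent (⟨z, hzG⟩ : G), (x : X) ∈ connectedComponentIn F z := by
    intro x hx
    refine connectedComponentIn_mono z (Set.inter_subset_left (t := Metric.closedBall z r)) ?_
    rw [connectedComponentIn_eq_image hzG]
    exact ⟨x, hx, rfl⟩
  set U : Set G := {x | (x : X) ∈ Metric.ball z r ∧ (x : X) ∉ C}
  have hUo : IsOpen U :=
    (Metric.isOpen_ball.inter hC.isOpen_compl).preimage continuous_subtype_val
  have hsub : ∃ V : { s : Set G // IsClopen s ∧ (⟨z, hzG⟩ : G) ∈ s }, (V : Set G) ⊆ U := by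
    have : Nonempty { s : Set G // IsClopen s ∧ (⟨z, hzG⟩ : G) ∈ s } :=
      ⟨⟨Set.univ, isClopen_univ, trivial⟩⟩
    refine exists_subset_nhds_of_compactSpace ?_ (fun V ↦ V.2.1.1) ?_
    · intro V W
      exact ⟨⟨V ∩ W, V.2.1.inter W.2.1, V.2.2, W.2.2⟩, Set.inter_subset_left,
        Set.inter_subset_right⟩
    · intro x hx
      rw [← connectedComponent_eq_iInter_isClopen] at hx
      have hx' := hcomp x hx
      exact hUo.mem_nhds ⟨hr hx', Set.disjoint_left.mp hd hx'⟩
  obtain ⟨⟨V, hV, hzV⟩, hVU⟩ := hsub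
  refine ⟨(↑) '' V, hV.1.isCompact.image continuous_subtype_val, ⟨_, hzV, rfl⟩, ?_, ?_, ?_⟩
  · rintro _ ⟨x, -, rfl⟩
    exact x.2.1
  · rw [Set.disjoint_left]
    rintro _ ⟨x, hx, rfl⟩
    exact (hVU hx).2
  · rintro _ ⟨x, hx, rfl⟩
    obtain ⟨O, hO, hOV⟩ := isOpen_induced_iff.mp hV.2
    have hxO : (x : X) ∈ O := by
      rw [← hOV] at hx
      exact hx
    filter_upwards [hO.mem_nhds hxO, Metric.isOpen_ball.mem_nhds (hVU hx).1] with y hyO hyr hyF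
    refine ⟨⟨y, hyF, Metric.ball_subset_closedBall hyr⟩, ?_, rfl⟩
    rw [← hOV]
    exact hyO

lemma hasDerivAt_ratFun (P Q : ℂ[X]) {z : ℂ} (hz : P.eval z ≠ 0) :
    HasDerivAt (ratFun P Q)
      ((Q.derivative * P - Q * P.derivative).eval z / P.eval z ^ 2) z := by
  have h := (Q.hasDerivAt z).div (P.hasDerivAt z) hz
  rw [← Polynomial.eval_mul, ← Polynomial.eval_mul, ← Polynomial.eval_sub] at h
  exact h

lemma eventually_eval_ne_zero {P : ℂ[X]} {z : ℂ} (hz : P.eval z ≠ 0) :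
    ∀ᶠ w in 𝓝 z, P.eval w ≠ 0 :=
  P.continuous.continuousAt.eventually_ne hz

/-- A nonzero polynomial has no zeros in a punctured neighbourhood of any point. -/
lemma eventually_nhdsNE_eval_ne_zero {P : ℂ[X]} (hP : P ≠ 0) (z : ℂ) :
    ∀ᶠ w in 𝓝[≠] z, P.eval w ≠ 0 := by
  have hfin : {w : ℂ | P.IsRoot w}.Finite := P.finite_setOfPred_isRoot hP
  have h : ∀ᶠ w in 𝓝[≠] z, w ∉ {w : ℂ | P.IsRoot w} \ {z} :=
    nhdsWithin_le_nhds <| (hfin.subset Set.sdiff_subset).isClosed.isOpen_compl.mem_nhds (by simp)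
  filter_upwards [h, self_mem_nhdsWithin] with w hw hwz h0
  exact hw ⟨h0, hwz⟩

lemma analyticAt_deriv_ratFun (P Q : ℂ[X]) {z : ℂ} (hz : P.eval z ≠ 0) :
    AnalyticAt ℂ (deriv (ratFun P Q)) z :=
  ((AnalyticOnNhd.eval_polynomial Q z (Set.mem_univ z)).div
    (AnalyticOnNhd.eval_polynomial P z (Set.mem_univ z)) hz).deriv

lemma isFinitePole_of_eval_eq_zero {P Q : ℂ[X]} (hP : P ≠ 0) (hPQ : IsCoprime P Q) {p : ℂ}
    (hp : P.eval p = 0) : IsFinitePole P Q p := by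
  have hQ : Q.eval p ≠ 0 := by
    obtain ⟨a, b, hab⟩ := hPQ
    intro h
    simpa [hp, h] using congrArg (Polynomial.eval p) hab
  have haP : AnalyticAt ℂ (fun w ↦ P.eval w) p :=
    AnalyticOnNhd.eval_polynomial P p (Set.mem_univ p)
  have haQ : AnalyticAt ℂ (fun w ↦ Q.eval w) p :=
    AnalyticOnNhd.eval_polynomial Q p (Set.mem_univ p)
  have hordQ : meromorphicOrderAt (fun w ↦ Q.eval w) p = 0 :=
    (tendsto_ne_zero_iff_meromorphicOrderAt_eq_zero haQ.meromorphicAt).mp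
      ⟨_, hQ, haQ.continuousAt.tendsto.mono_left nhdsWithin_le_nhds⟩
  have hordP : 0 < meromorphicOrderAt (fun w ↦ P.eval w) p := by
    refine (tendsto_zero_iff_meromorphicOrderAt_pos haP.meromorphicAt).mp ?_
    simpa [hp] using haP.continuousAt.tendsto.mono_left (nhdsWithin_le_nhds (s := {p}ᶜ))
  have hordP' : meromorphicOrderAt (fun w ↦ P.eval w) p ≠ ⊤ :=
    (meromorphicOrderAt_ne_top_iff_eventually_ne_zero haP.meromorphicAt).mpr
      (eventually_nhdsNE_eval_ne_zero hP p)
  have hfun : ratFun P Q = (fun w ↦ Q.eval w) / fun w ↦ P.eval w := rfl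
  rw [IsFinitePole, hfun, meromorphicOrderAt_div haQ.meromorphicAt haP.meromorphicAt, hordQ]
  lift meromorphicOrderAt (fun w ↦ P.eval w) p to ℤ using hordP' with n
  rw [zero_sub]
  exact_mod_cast neg_lt_zero.mpr (show 0 < n by exact_mod_cast hordP)

/-- Away from the poles, `R'` is real on the whole curve and not only on its regular locus. -/
lemma im_deriv_ratFun_eq_zero {P Q : ℂ[X]} {s : ℂ} (hs : s ∈ inflectionCurve P Q)
    (hPs : P.eval s ≠ 0) : (deriv (ratFun P Q) s).im = 0 := by
  by_contra h
  have hev : ∀ᶠ w in 𝓝 s, (deriv (ratFun P Q) w).im ≠ 0 :=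
    (Complex.continuous_im.continuousAt.comp
      (analyticAt_deriv_ratFun P Q hPs).continuousAt).eventually_ne h
  obtain ⟨w, hw, hw'⟩ := ((mem_closure_iff_frequently.mp hs).and_eventually hev).exists
  exact hw' hw.2.2

/-- If `R'` is constant and real near a single point, then it is so everywhere, and the curve is
the whole plane. -/
lemma inflectionCurve_eq_univ {P Q : ℂ[X]} (hP : P ≠ 0) (hQ : Q ≠ 0) {s c : ℂ}
    (hPs : P.eval s ≠ 0) (hc : c.im = 0) (h : ∀ᶠ w in 𝓝 s, deriv (ratFun P Q) w = c) :
    inflectionCurve P Q = Set.univ := by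
  have hpoly : Q.derivative * P - Q * P.derivative - C c * P ^ 2 = 0 := by
    refine Polynomial.eq_zero_of_infinite_isRoot _ (infinite_of_mem_nhds s ?_)
    filter_upwards [h, eventually_eval_ne_zero hPs] with w hw hPw
    rw [(hasDerivAt_ratFun P Q hPw).deriv, div_eq_iff (pow_ne_zero 2 hPw)] at hw
    simp only [Polynomial.IsRoot.def]
    rw [Polynomial.eval_sub, hw]
    simp
  have hfin : {w : ℂ | (P * Q).IsRoot w}.Finite := (P * Q).finite_setOfPred_isRoot (mul_ne_zero hP hQ)
  have hdense : Dense {w : ℂ | (P * Q).IsRoot w}ᶜ := hfin.countable.dense_compl ℂ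
  refine (hdense.mono ?_).closure_eq
  intro w hw
  have hw' : P.eval w ≠ 0 ∧ Q.eval w ≠ 0 := by simpa using hw
  refine ⟨div_ne_zero hw'.2 hw'.1, hw'.1, ?_⟩
  rw [(hasDerivAt_ratFun P Q hw'.1).deriv, sub_eq_zero.mp hpoly]
  simp [hw'.1, hc]

theorem mainTheorem3 (P Q : ℂ[X]) (hP : P ≠ 0) (hPQ : IsCoprime P Q)
    (z : ℂ) (hz : z ∈ inflectionCurve P Q)
    (hb : Bornology.IsBounded (connectedComponentIn (inflectionCurve P Q) z)) :
    ∃ p ∈ connectedComponentIn (inflectionCurve P Q) z, IsFinitePole P Q p := by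
  by_contra! hno
  have hQ : Q ≠ 0 := by
    rintro rfl
    obtain ⟨w, hw⟩ := closure_nonempty_iff.mp ⟨z, hz⟩
    exact hw.1 (by simp [ratFun])
  have hd : Disjoint (connectedComponentIn (inflectionCurve P Q) z) {w | P.eval w = 0} :=
    Set.disjoint_left.mpr fun w hw h0 ↦ hno w hw (isFinitePole_of_eval_eq_zero hP hPQ h0)
  obtain ⟨S, hSc, hzS, hSF, hSP, hSo⟩ := exists_isCompact_of_isBounded_connectedComponentIn
    isClosed_closure (isClosed_eq P.continuous continuous_const) hz hb hd
  have hPS : ∀ w ∈ S, P.eval w ≠ 0 := fun w hw ↦ Set.disjoint_left.mp hSP hw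
  have hcont : ContinuousOn (fun w ↦ (deriv (ratFun P Q) w).re) S := fun w hw ↦
    (Complex.continuous_re.continuousAt.comp
      (analyticAt_deriv_ratFun P Q (hPS w hw)).continuousAt).continuousWithinAt
  obtain ⟨s, hsS, hmax⟩ := hSc.exists_isMaxOn ⟨z, hzS⟩ hcont
  have him := im_deriv_ratFun_eq_zero (hSF hsS) (hPS s hsS)
  rcases (analyticAt_deriv_ratFun P Q (hPS s hsS)).eventually_constant_or_nhds_le_map_nhds
    with hconst | hopen
  · rw [inflectionCurve_eq_univ hP hQ (hPS s hsS) him hconst, connectedComponentIn_univ,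
      PreconnectedSpace.connectedComponent_eq_univ] at hb
    exact NormedSpace.unbounded_univ ℂ ℂ hb
  · -- Near `s`, a point other than `s` with real `R'` is in the regular locus, hence in `S`.
    have hnear : ∀ᶠ w in 𝓝 s, w ≠ s → (deriv (ratFun P Q) w).im = 0 → w ∈ S := by
      filter_upwards [hSo s hsS, eventually_eval_ne_zero (hPS s hsS),
        eventually_nhdsWithin_iff.mp (eventually_nhdsNE_eval_ne_zero hQ s)] with w hw hPw hQw hws hi
      exact hw (subset_closure ⟨div_ne_zero (hQw hws) hPw, hPw, hi⟩)
    have himage := hopen (image_mem_map hnear)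
    have hline : Tendsto (fun t : ℝ ↦ deriv (ratFun P Q) s + (t : ℂ)) (𝓝[>] 0)
        (𝓝 (deriv (ratFun P Q) s)) := by
      have : Continuous fun t : ℝ ↦ deriv (ratFun P Q) s + (t : ℂ) := by fun_prop
      simpa using (this.tendsto 0).mono_left nhdsWithin_le_nhds
    obtain ⟨t, ⟨w, hw, hwt⟩, ht⟩ :=
      ((hline.eventually himage).and (self_mem_nhdsWithin (s := Set.Ioi (0 : ℝ)))).exists
    have ht0 : 0 < t := ht
    have hre : (deriv (ratFun P Q) w).re = (deriv (ratFun P Q) s).re + t := by simp [hwt]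
    have hws : w ≠ s := by
      rintro rfl
      linarith
    have hle : (deriv (ratFun P Q) w).re ≤ (deriv (ratFun P Q) s).re :=
      hmax (hw hws (by simp [hwt, him]))
    linarith
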